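/- Let $\ell\ge 1$, and for $1\le i<k\le 2\ell$ let $I_{ki}$ be the $2\ell\times 2\ell$ matrix with $-1$ in the place $(k,i)$, $1$ in the place $(i,k)$ and zeros elsewhere. Consider the Cartan subalgebra $\mathfrak h=\langle I_{21},I_{43},\dots,I_{2\ell,2\ell-1}\rangle_{\mathbb C}$ of $\mathfrak{so}(2\ell,\mathbb C)$, and define $\epsilon_j\in\mathfrak h^*$ by $\epsilon_j\big(i(x_1I_{21}+\dots+x_\ell I_{2\ell,2\ell-1})\big)=x_j$. Take as positive roots $\Delta^+=\{\epsilon_j+\epsilon_k,\ \epsilon_j-\epsilon_k : 1\le j<k\le\ell\}$, with root vectors $$X_{\epsilon_j\pm\epsilon_k}=I_{2k-1,2j-1}\mp I_{2k,2j}-i\,(I_{2k-1,2j}\pm I_{2k,2j-1}).$$ For a continuous irreducible representation $\pi$ of $\mathrm{SO}(2\ell)$ on a finite dimensional complex vector space $V$, let $\dot\pi$ be the complex linear extension of its differential to $\mathfrak{so}(2\ell,\mathbb C)$. We say that $(m_1,\dots,m_\ell)\in\mathbb Z^\ell$ is the highest weight of $\pi$ if there is a vector $v\ne0$ in $V$ with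 $\dot\pi(H)v=\sum_j m_j\epsilon_j(H)\,v$ for all $H\in\mathfrak h$ and $\dot\pi(X_\alpha)v=0$ for all $\alpha\in\Delta^+$. Let $a=\operatorname{diag}(1,\dots,1,-1)\in\mathrm{O}(2\ell)$, let $\phi$ be the automorphism $\phi(k)=aka$ of $\mathrm{SO}(2\ell)$, and let $\pi_\phi=\pi\circ\phi$, acting on the same space $V$. **Theorem.** If $\pi$ is a continuous irreducible finite dimensional complex representation of $\mathrm{SO}(2\ell)$ with highest weight $(m_1,\dots,m_{\ell-1},m_\ell)$, then $\pi_\phi$ is again a continuous irreducible representation of $\mathrm{SO}(2\ell)$, and its highest weight is $(m_1,\dots,m_{\ell-1},-m_\ell)$. -/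

import Mathlib

open Matrix LieAlgebra.Orthogonal

namespace SORep

noncomputable section

/-- The compact group `SO(n)`. -/
abbrev SO (n : ℕ) := ↥(Matrix.specialOrthogonalGroup (Fin n) ℝ)

/-! ### The automorphism `φ = Ad(a)` of `SO(n)`, `a = diag(1, …, 1, -1)` -/

/-- The matrix `a = diag(1, …, 1, -1)`. -/
def reflMatrix (n : ℕ) : Matrix (Fin n) (Fin n) ℝ :=
  Matrix.diagonal fun i => if (i : ℕ) + 1 = n then -1 else 1

lemma reflMatrix_mul_self (n : ℕ) : reflMatrix n * reflMatrix n = 1 := by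
  rw [reflMatrix, Matrix.diagonal_mul_diagonal, ← Matrix.diagonal_one]
  congr 1
  funext i
  split_ifs <;> simp

lemma reflMatrix_transpose (n : ℕ) : (reflMatrix n)ᵀ = reflMatrix n :=
  Matrix.diagonal_transpose _

lemma reflMatrix_conj_mem {n : ℕ} {k : Matrix (Fin n) (Fin n) ℝ}
    (hk : k ∈ Matrix.specialOrthogonalGroup (Fin n) ℝ) :
    reflMatrix n * k * reflMatrix n ∈ Matrix.specialOrthogonalGroup (Fin n) ℝ := by
  rw [Matrix.mem_specialOrthogonalGroup_iff, Matrix.mem_orthogonalGroup_iff] at hk ⊢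
  obtain ⟨h1, h2⟩ := hk
  have ha := reflMatrix_mul_self n
  refine ⟨?_, ?_⟩
  · rw [Matrix.transpose_mul, Matrix.transpose_mul, reflMatrix_transpose]
    calc reflMatrix n * k * reflMatrix n * (reflMatrix n * (kᵀ * reflMatrix n))
        = reflMatrix n * (k * (reflMatrix n * reflMatrix n) * kᵀ) * reflMatrix n := by
          simp only [Matrix.mul_assoc]
      _ = 1 := by rw [ha, Matrix.mul_one, h1, Matrix.mul_one, ha]
  · have hd : (reflMatrix n).det * (reflMatrix n).det = 1 := by
      rw [← Matrix.det_mul, ha, Matrix.det_one]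
    rw [Matrix.det_mul, Matrix.det_mul, h2, mul_one, hd]

lemma reflMatrix_conj_conj {n : ℕ} (k : Matrix (Fin n) (Fin n) ℝ) :
    reflMatrix n * (reflMatrix n * k * reflMatrix n) * reflMatrix n = k := by
  have ha := reflMatrix_mul_self n
  calc reflMatrix n * (reflMatrix n * k * reflMatrix n) * reflMatrix n
      = reflMatrix n * reflMatrix n * k * (reflMatrix n * reflMatrix n) := by
        simp only [Matrix.mul_assoc]
    _ = k := by rw [ha, Matrix.one_mul, Matrix.mul_one]

/-- The automorphism `φ(k) = a k a` of `SO(n)`; as `a⁻¹ = a`, this is conjugation by `a`. -/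
def phi (n : ℕ) : SO n ≃* SO n where
  toFun k := ⟨reflMatrix n * (k : Matrix (Fin n) (Fin n) ℝ) * reflMatrix n,
    reflMatrix_conj_mem k.2⟩
  invFun k := ⟨reflMatrix n * (k : Matrix (Fin n) (Fin n) ℝ) * reflMatrix n,
    reflMatrix_conj_mem k.2⟩
  left_inv k := Subtype.ext (reflMatrix_conj_conj _)
  right_inv k := Subtype.ext (reflMatrix_conj_conj _)
  map_mul' k k' := Subtype.ext <| by
    have ha := reflMatrix_mul_self n
    change reflMatrix n * ((k : Matrix (Fin n) (Fin n) ℝ) * (k' : Matrix (Fin n) (Fin n) ℝ))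
        * reflMatrix n
      = (reflMatrix n * (k : Matrix (Fin n) (Fin n) ℝ) * reflMatrix n)
        * (reflMatrix n * (k' : Matrix (Fin n) (Fin n) ℝ) * reflMatrix n)
    symm
    calc (reflMatrix n * (k : Matrix (Fin n) (Fin n) ℝ) * reflMatrix n)
        * (reflMatrix n * (k' : Matrix (Fin n) (Fin n) ℝ) * reflMatrix n)
        = reflMatrix n * ((k : Matrix (Fin n) (Fin n) ℝ) * (reflMatrix n * reflMatrix n)
          * (k' : Matrix (Fin n) (Fin n) ℝ)) * reflMatrix n := by
          simp only [Matrix.mul_assoc]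
      _ = _ := by rw [ha, Matrix.mul_one]

/-! ### The differential of a representation -/

lemma exp_mem_SO {n : ℕ} {X : Matrix (Fin n) (Fin n) ℝ} (hX : X ∈ so (Fin n) ℝ) :
    NormedSpace.exp X ∈ Matrix.specialOrthogonalGroup (Fin n) ℝ := by
  have key : ∀ Y : Matrix (Fin n) (Fin n) ℝ, Yᵀ = -Y →
      NormedSpace.exp Y * (NormedSpace.exp Y)ᵀ = 1 := by
    intro Y hY
    rw [← Matrix.exp_transpose, hY,
      ← Matrix.exp_add_of_commute _ _ ((Commute.refl Y).neg_right), add_neg_cancel,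
      NormedSpace.exp_zero]
  rw [mem_so] at hX
  rw [Matrix.mem_specialOrthogonalGroup_iff, Matrix.mem_orthogonalGroup_iff]
  refine ⟨?_, ?_⟩
  · exact key X hX
  · set Y : Matrix (Fin n) (Fin n) ℝ := (2⁻¹ : ℝ) • X with hYdef
    have hY : Yᵀ = -Y := by rw [hYdef, Matrix.transpose_smul, hX, smul_neg]
    have hXY : X = Y + Y := by rw [hYdef, ← add_smul]; norm_num
    have h := congrArg Matrix.det (key Y hY)
    rw [Matrix.det_mul, Matrix.det_transpose, Matrix.det_one] at h
    rw [hXY, Matrix.exp_add_of_commute _ _ (Commute.refl Y), Matrix.det_mul, h]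

/-- The exponential map `𝔰𝔬(n) → SO(n)`. -/
def expSO {n : ℕ} (X : so (Fin n) ℝ) : SO n :=
  ⟨NormedSpace.exp (X : Matrix (Fin n) (Fin n) ℝ), exp_mem_SO X.2⟩

/-- The entrywise real part of an element of `𝔰𝔬(n, ℂ)`. -/
def rePart {n : ℕ} (Z : so (Fin n) ℂ) : so (Fin n) ℝ :=
  ⟨(Z : Matrix (Fin n) (Fin n) ℂ).map Complex.re, by
    have h := (mem_so (Fin n) ℂ _).1 Z.2
    rw [mem_so]
    ext i j
    simpa using congrArg Complex.re (congrFun (congrFun h i) j)⟩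

/-- The entrywise imaginary part of an element of `𝔰𝔬(n, ℂ)`. -/
def imPart {n : ℕ} (Z : so (Fin n) ℂ) : so (Fin n) ℝ :=
  ⟨(Z : Matrix (Fin n) (Fin n) ℂ).map Complex.im, by
    have h := (mem_so (Fin n) ℂ _).1 Z.2
    rw [mem_so]
    ext i j
    simpa using congrArg Complex.im (congrFun (congrFun h i) j)⟩

section Rep

variable {n : ℕ} {V : Type*} [NormedAddCommGroup V] [NormedSpace ℂ V]

/-- The differential of a representation of `SO(n)`:
`dπ(X) v = d/dt π(exp(tX)) v` at `t = 0`, for `X ∈ 𝔰𝔬(n)`. The derivative exists whenever `π` is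
continuous and finite dimensional. -/
def differential (π : Representation ℂ (SO n) V) (X : so (Fin n) ℝ) (v : V) : V :=
  deriv (fun t : ℝ => π (expSO (t • X)) v) 0

/-- The complex linear extension of the differential to `𝔰𝔬(n, ℂ) = 𝔰𝔬(n) ⊕ i 𝔰𝔬(n)`:
`dπ(X + iY) = dπ(X) + i dπ(Y)` for `X, Y ∈ 𝔰𝔬(n)`. -/
def complexDifferential (π : Representation ℂ (SO n) V) (Z : so (Fin n) ℂ) (v : V) : V :=
  differential π (rePart Z) v + Complex.I • differential π (imPart Z) v

/-- `π` belongs to the class of continuous irreducible representations of `SO(n)`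
(the finite-dimensionality of `V` is imposed separately). -/
structure IsContIrred (π : Representation ℂ (SO n) V) : Prop where
  continuous : ∀ v : V, Continuous fun k : SO n => π k v
  irreducible : π.IsIrreducible

/-- The representation `π_φ = π ∘ φ`. -/
def twist (π : Representation ℂ (SO n) V) : Representation ℂ (SO n) V :=
  π.comp (phi n).toMonoidHom

end Rep

/-! ### Cartan subalgebra, root vectors and highest weights for `𝔰𝔬(2ℓ, ℂ)` -/

/-- The matrix `I_{ki}` with `-1` in the place `(k, i)`, `1` in the place `(i, k)` and zeros
elsewhere. -/
def rot {n : ℕ} (k i : Fin n) : so (Fin n) ℂ :=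
  ⟨Matrix.single i k 1 - Matrix.single k i 1, by
    rw [mem_so, Matrix.transpose_sub, Matrix.transpose_single, Matrix.transpose_single, neg_sub]⟩

variable {ℓ : ℕ}

/-- The position `2j - 1` of `{1, …, 2ℓ}`; here `j` and the positions are counted from zero. -/
def odd (j : Fin ℓ) : Fin (2 * ℓ) := ⟨2 * j, by omega⟩

/-- The position `2j` of `{1, …, 2ℓ}`; here `j` and the positions are counted from zero. -/
def even (j : Fin ℓ) : Fin (2 * ℓ) := ⟨2 * j + 1, by omega⟩

/-- The element `H = i (x₁ I_{21} + ⋯ + x_ℓ I_{2ℓ,2ℓ-1})` of the Cartan subalgebra; its coordinates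
are `ε_j(H) = x_j`, and every element of the Cartan subalgebra has this form. -/
def cartan (x : Fin ℓ → ℂ) : so (Fin (2 * ℓ)) ℂ :=
  Complex.I • ∑ j, x j • rot (even j) (odd j)

/-- The root vector `X_{ε_j + ε_k}` (for `j < k`). -/
def rootAdd (j k : Fin ℓ) : so (Fin (2 * ℓ)) ℂ :=
  rot (odd k) (odd j) - rot (even k) (even j)
    - Complex.I • (rot (odd k) (even j) + rot (even k) (odd j))

/-- The root vector `X_{ε_j - ε_k}` (for `j < k`). -/
def rootSub (j k : Fin ℓ) : so (Fin (2 * ℓ)) ℂ :=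
  rot (odd k) (odd j) + rot (even k) (even j)
    - Complex.I • (rot (odd k) (even j) - rot (even k) (odd j))

/-- `v` is a highest weight vector of weight `m₁ε₁ + ⋯ + m_ℓε_ℓ` for the choice
`Δ⁺ = {ε_j + ε_k, ε_j - ε_k : j < k}` of positive roots: it is a nonzero weight vector annihilated
by the root vectors of all the positive roots. -/
structure IsHighestWeightVector {V : Type*} [NormedAddCommGroup V] [NormedSpace ℂ V]
    (π : Representation ℂ (SO (2 * ℓ)) V) (m : Fin ℓ → ℤ) (v : V) : Prop where
  ne_zero : v ≠ 0
  weight : ∀ x : Fin ℓ → ℂ,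
    complexDifferential π (cartan x) v = (∑ j, (m j : ℂ) * x j) • v
  rootAdd_eq_zero : ∀ j k : Fin ℓ, j < k → complexDifferential π (rootAdd j k) v = 0
  rootSub_eq_zero : ∀ j k : Fin ℓ, j < k → complexDifferential π (rootSub j k) v = 0

/-- `m = (m₁, …, m_ℓ)` is the highest weight of the irreducible representation `π` of `SO(2ℓ)`,
that is, the weight of its highest weight vector (which is unique up to scalars). -/
def IsHighestWeight {V : Type*} [NormedAddCommGroup V] [NormedSpace ℂ V]
    (π : Representation ℂ (SO (2 * ℓ)) V) (m : Fin ℓ → ℤ) : Prop :=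
  ∃ v : V, IsHighestWeightVector π m v

/-- The tuple `(m₁, …, m_{ℓ-1}, -m_ℓ)`. -/
def negLast (m : Fin ℓ → ℤ) : Fin ℓ → ℤ :=
  fun j => if (j : ℕ) + 1 = ℓ then -m j else m j

end

end SORep

namespace SORep

/-! ### Continuity, irreducibility and differential of the twisted representation. -/

section Twist

variable {n : ℕ} {V : Type*} [NormedAddCommGroup V] [NormedSpace ℂ V]

/-! A highest weight vector of `π` serves unchanged for `π_φ`. The differential of `π_φ` is that of
`π` composed with conjugation by `a` (`complexDifferential_twist`), which multiplies `I_{ki}` by the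
product of the `k`-th and `i`-th signs of `a` (`rot_conj`). It therefore preserves the Cartan
subalgebra, negates `ε_ℓ`, and permutes the positive root vectors by swapping those of `ε_j ± ε_ℓ`.
Irreducibility passes over because `φ` is bijective, so both actions have the same invariant
subspaces. -/

@[simp]
lemma coe_phi (k : SO n) :
    (phi n k : Matrix (Fin n) (Fin n) ℝ) = reflMatrix n * k * reflMatrix n := rfl

@[simp]
lemma twist_apply (π : Representation ℂ (SO n) V) (k : SO n) : twist π k = π (phi n k) := rfl

lemma continuous_phi : Continuous (phi n) :=
  Continuous.subtype_mk (by fun_prop) _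

/-- The exponential map intertwines conjugation by `a` on `𝔰𝔬(n)` with `φ`. -/
lemma phi_expSO {X Y : so (Fin n) ℝ}
    (h : (Y : Matrix (Fin n) (Fin n) ℝ) = reflMatrix n * X * reflMatrix n) :
    phi n (expSO X) = expSO Y := by
  have hinv : (reflMatrix n)⁻¹ = reflMatrix n := Matrix.inv_eq_right_inv (reflMatrix_mul_self n)
  have hunit : IsUnit (reflMatrix n) :=
    (Units.mk _ _ (reflMatrix_mul_self n) (reflMatrix_mul_self n)).isUnit
  have := Matrix.exp_conj (reflMatrix n) (X : Matrix (Fin n) (Fin n) ℝ) hunit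
  rw [hinv] at this
  apply Subtype.ext
  simp only [coe_phi, expSO, h, this]

/-- The two curves being differentiated coincide for every `t`, so no differentiability is needed.
-/
lemma differential_twist (π : Representation ℂ (SO n) V) {X Y : so (Fin n) ℝ}
    (h : (Y : Matrix (Fin n) (Fin n) ℝ) = reflMatrix n * X * reflMatrix n) (v : V) :
    differential (twist π) X v = differential π Y v := by
  unfold differential
  congr 1
  funext t
  rw [twist_apply, phi_expSO (Y := t • Y)]
  simp [h]

/-- As `a` is real, conjugation by it commutes with taking real and imaginary parts. The entrywise
hypothesis is the form in which `rot_conj` applies. -/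
lemma complexDifferential_twist (π : Representation ℂ (SO n) V) {Z W : so (Fin n) ℂ}
    (h : ∀ i j, (W : Matrix (Fin n) (Fin n) ℂ) i j =
      (if (i : ℕ) + 1 = n then -1 else 1) * (Z : Matrix (Fin n) (Fin n) ℂ) i j *
        (if (j : ℕ) + 1 = n then -1 else 1)) (v : V) :
    complexDifferential (twist π) Z v = complexDifferential π W v := by
  unfold complexDifferential
  rw [differential_twist π (Y := rePart W), differential_twist π (Y := imPart W)]
  · ext i j
    simp only [imPart, reflMatrix, Matrix.map_apply, Matrix.mul_diagonal, Matrix.diagonal_mul, h]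
    split_ifs <;> simp
  · ext i j
    simp only [rePart, reflMatrix, Matrix.map_apply, Matrix.mul_diagonal, Matrix.diagonal_mul, h]
    split_ifs <;> simp

/-- Subspaces invariant under `π` are the same as those invariant under `π_φ`. -/
def subrepresentationTwist (π : Representation ℂ (SO n) V) :
    Subrepresentation π ≃o Subrepresentation (twist π) where
  toFun W := ⟨W.toSubmodule, fun g _ hv => W.apply_mem_toSubmodule (phi n g) hv⟩
  -- Surjectivity of `φ`: `π g` is the twisted action of `φ⁻¹ g`.
  invFun W := ⟨W.toSubmodule, fun g v hv => by
    simpa using W.apply_mem_toSubmodule ((phi n).symm g) hv⟩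
  left_inv _ := rfl
  right_inv _ := rfl
  map_rel_iff' := Iff.rfl

lemma IsContIrred.twist {π : Representation ℂ (SO n) V} (hπ : IsContIrred π) :
    IsContIrred (SORep.twist π) where
  continuous v := (hπ.continuous v).comp continuous_phi
  irreducible :=
    have : π.IsIrreducible := hπ.irreducible
    (subrepresentationTwist π).isSimpleOrder_iff.1 this

end Twist

/-! ### Effect of conjugation by `a` on the Cartan subalgebra and the root vectors. -/

section HighestWeight

variable {ℓ : ℕ}

lemma rot_apply {n : ℕ} (k i a b : Fin n) :
    (rot k i : Matrix (Fin n) (Fin n) ℂ) a b =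
      (if i = a ∧ k = b then 1 else 0) - (if k = a ∧ i = b then 1 else 0) := by
  simp [rot, Matrix.single_apply]

-- Counted from zero, the entry `-1` of `a` sits at `2ℓ - 1`, the even position of the last index.
@[simp]
lemma even_isLast (j : Fin ℓ) : (even j : ℕ) + 1 = 2 * ℓ ↔ (j : ℕ) + 1 = ℓ := by
  simp only [even]; omega

@[simp]
lemma odd_not_isLast (j : Fin ℓ) : ¬ (odd j : ℕ) + 1 = 2 * ℓ := by
  simp only [odd]; omega

/-- Conjugation by `diag(1, …, 1, -1)` scales `I_{ki}` by the product of the `k`-th and `i`-th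
diagonal entries. -/
lemma rot_conj {n : ℕ} (k i a b : Fin n) :
    (if (a : ℕ) + 1 = n then (-1 : ℂ) else 1) * (rot k i : Matrix (Fin n) (Fin n) ℂ) a b *
        (if (b : ℕ) + 1 = n then -1 else 1) =
      (if (k : ℕ) + 1 = n then -1 else 1) * (if (i : ℕ) + 1 = n then -1 else 1) *
        (rot k i : Matrix (Fin n) (Fin n) ℂ) a b := by
  -- Any diagonal `s` works: the entry can be nonzero only at `(i, k)` and `(k, i)`, where both
  -- sides carry the factor `s k * s i`.
  have key : ∀ (s : Fin n → ℂ), s a * (rot k i : Matrix (Fin n) (Fin n) ℂ) a b * s b =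
      s k * s i * (rot k i : Matrix (Fin n) (Fin n) ℂ) a b := by
    intro s
    rw [rot_apply]
    by_cases h1 : i = a ∧ k = b
    · obtain ⟨rfl, rfl⟩ := h1; ring
    · by_cases h2 : k = a ∧ i = b
      · obtain ⟨rfl, rfl⟩ := h2; ring
      · simp [h1, h2]
  exact key fun c => if (c : ℕ) + 1 = n then -1 else 1

lemma cartan_apply (x : Fin ℓ → ℂ) (a b : Fin (2 * ℓ)) :
    (cartan x : Matrix (Fin (2 * ℓ)) (Fin (2 * ℓ)) ℂ) a b =
      Complex.I * ∑ j, x j * (rot (even j) (odd j) : Matrix (Fin (2 * ℓ)) (Fin (2 * ℓ)) ℂ) a b := by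
  simp [cartan, Matrix.sum_apply]

lemma rootAdd_apply (j k : Fin ℓ) (a b : Fin (2 * ℓ)) :
    (rootAdd j k : Matrix (Fin (2 * ℓ)) (Fin (2 * ℓ)) ℂ) a b =
      (rot (odd k) (odd j)).1 a b - (rot (even k) (even j)).1 a b
        - Complex.I * ((rot (odd k) (even j)).1 a b + (rot (even k) (odd j)).1 a b) := rfl

lemma rootSub_apply (j k : Fin ℓ) (a b : Fin (2 * ℓ)) :
    (rootSub j k : Matrix (Fin (2 * ℓ)) (Fin (2 * ℓ)) ℂ) a b =
      (rot (odd k) (odd j)).1 a b + (rot (even k) (even j)).1 a b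
        - Complex.I * ((rot (odd k) (even j)).1 a b - (rot (even k) (odd j)).1 a b) := rfl

variable {V : Type*} [NormedAddCommGroup V] [NormedSpace ℂ V]
  (π : Representation ℂ (SO (2 * ℓ)) V)

lemma complexDifferential_twist_cartan (x : Fin ℓ → ℂ) (v : V) :
    complexDifferential (twist π) (cartan x) v =
      complexDifferential π (cartan fun j => if (j : ℕ) + 1 = ℓ then -x j else x j) v := by
  refine complexDifferential_twist π (fun a b => ?_) v
  rw [cartan_apply, cartan_apply, mul_left_comm, mul_assoc]
  congr 1
  rw [Finset.mul_sum, Finset.sum_mul]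
  refine Finset.sum_congr rfl fun j _ => ?_
  have h := rot_conj (even j) (odd j) a b
  simp only [even_isLast, odd_not_isLast, if_false, mul_one] at h
  rw [mul_left_comm, mul_assoc, h]
  split_ifs <;> ring

/-- Conjugation by `a` exchanges the root vectors of `ε_j + ε_ℓ` and `ε_j - ε_ℓ` and fixes those
of the other positive roots. -/
lemma complexDifferential_twist_rootAdd {j k : Fin ℓ} (hjk : j < k) (v : V) :
    complexDifferential (twist π) (rootAdd j k) v =
      complexDifferential π (if (k : ℕ) + 1 = ℓ then rootSub j k else rootAdd j k) v := by
  refine complexDifferential_twist π (fun a b => ?_) v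
  -- Since `j < k`, only `even k` can be the last position, so exactly the terms containing it
  -- change sign when `k` is last.
  have hj : ¬ (j : ℕ) + 1 = ℓ := by have := k.2; have : (j : ℕ) < k := hjk; omega
  have h1 := rot_conj (odd k) (odd j) a b
  have h2 := rot_conj (even k) (even j) a b
  have h3 := rot_conj (odd k) (even j) a b
  have h4 := rot_conj (even k) (odd j) a b
  simp only [even_isLast, odd_not_isLast, if_false, hj] at h1 h2 h3 h4
  rw [rootAdd_apply]
  by_cases hk : (k : ℕ) + 1 = ℓ
  · simp only [hk, if_true] at h1 h2 h3 h4 ⊢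
    rw [rootSub_apply]
    linear_combination -h1 + h2 + Complex.I * (h3 + h4)
  · simp only [hk, if_false] at h1 h2 h3 h4 ⊢
    rw [rootAdd_apply]
    linear_combination -h1 + h2 + Complex.I * (h3 + h4)

lemma complexDifferential_twist_rootSub {j k : Fin ℓ} (hjk : j < k) (v : V) :
    complexDifferential (twist π) (rootSub j k) v =
      complexDifferential π (if (k : ℕ) + 1 = ℓ then rootAdd j k else rootSub j k) v := by
  refine complexDifferential_twist π (fun a b => ?_) v
  have hj : ¬ (j : ℕ) + 1 = ℓ := by have := k.2; have : (j : ℕ) < k := hjk; omega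
  have h1 := rot_conj (odd k) (odd j) a b
  have h2 := rot_conj (even k) (even j) a b
  have h3 := rot_conj (odd k) (even j) a b
  have h4 := rot_conj (even k) (odd j) a b
  simp only [even_isLast, odd_not_isLast, if_false, hj] at h1 h2 h3 h4
  rw [rootSub_apply]
  by_cases hk : (k : ℕ) + 1 = ℓ
  · simp only [hk, if_true] at h1 h2 h3 h4 ⊢
    rw [rootAdd_apply]
    linear_combination -h1 - h2 + Complex.I * (h3 - h4)
  · simp only [hk, if_false] at h1 h2 h3 h4 ⊢
    rw [rootSub_apply]
    linear_combination -h1 - h2 + Complex.I * (h3 - h4)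

variable {π}

/-- A highest weight vector of `π` is a highest weight vector of `π_φ`, with the last coordinate of
the weight negated. -/
lemma IsHighestWeightVector.twist {m : Fin ℓ → ℤ} {v : V} (h : IsHighestWeightVector π m v) :
    IsHighestWeightVector (SORep.twist π) (negLast m) v where
  ne_zero := h.ne_zero
  weight x := by
    -- The sign on the last `x j` is then moved onto `m j`.
    rw [complexDifferential_twist_cartan, h.weight]
    congr 1
    refine Finset.sum_congr rfl fun j _ => ?_
    simp only [negLast]
    split_ifs <;> simp
  rootAdd_eq_zero j k hjk := by
    rw [complexDifferential_twist_rootAdd π hjk]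
    split_ifs
    exacts [h.rootSub_eq_zero j k hjk, h.rootAdd_eq_zero j k hjk]
  rootSub_eq_zero j k hjk := by
    rw [complexDifferential_twist_rootSub π hjk]
    split_ifs
    exacts [h.rootAdd_eq_zero j k hjk, h.rootSub_eq_zero j k hjk]

end HighestWeight

end SORep

theorem mainTheorem4 (ℓ : ℕ) (hℓ : 1 ≤ ℓ)
    (V : Type*) [NormedAddCommGroup V] [NormedSpace ℂ V] [FiniteDimensional ℂ V]
    (π : Representation ℂ (SORep.SO (2 * ℓ)) V) (hπ : SORep.IsContIrred π)
    (m : Fin ℓ → ℤ) (hm : SORep.IsHighestWeight π m) :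
    SORep.IsContIrred (SORep.twist π) ∧
      SORep.IsHighestWeight (SORep.twist π) (SORep.negLast m) :=
  ⟨hπ.twist, hm.imp fun _ hv => hv.twist⟩
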